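/- Let $G$ be a connected Veblen graph with at least one edge, i.e. a finite loopless multigraph on a linearly ordered finite vertex set $V$ that is connected, has at least one edge and has all vertex degrees even. For an edge $e$ let $m(e)$ be its multiplicity, and let $\mathfrak{E}(G)$ be the set of Euler circuits of $G$: closed walks $v_0e_0v_1e_1\dots e_{m-1}v_0$ (with $e_i=\{v_i,v_{i+1}\}$, indices modulo $m$) that traverse each edge exactly once, parallel edges being distinguished, where two such walks are identified if they differ by a cyclic rotation (reversed walks are not identified). A rooting of $G$ is a sequence $R=((e_1,u_1),\dots,(e_m,u_m))$ with $u_i\in e_i$ and $u_1\le u_2\le\dots\le u_m$, such that $e_1,\dots,e_m$ are the edges of $G$ listed with multiplicity (parallel edges not being distinguished in $R$). Its digraph $D_R$ on $V$ has, for each $i$ with $e_i=\{u_i,w_i\}$, an arc from $u_i$ to $w_i$, multiplicities being added. The rooting is an Euler rooting if $D_R$ is Eulerian, i.e. has a directed Euler circuit. For an Eulerian $D=D_R$ let $\tau_D$ be the number of spanning arborescences of $D$ (parallel arcs distinguished) with a specified root, and let $\deg_D^-(v)$ be the in-degree of $v$. The associated coefficient of $G$ is $$C_G=\sum_{R}\frac{\tau_{D_R}}{\prod_{v\in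 V}\deg_{D_R}^-(v)},$$ the sum being over all Euler rootings $R$ of $G$. Then, for every choice of the roots used to compute the numbers $\tau_{D_R}$, $$C_G=\frac{|\mathfrak{E}(G)|}{\prod_{e}m(e)!},$$ where the product is over the distinct edges $e$ of $G$. -/

import Mathlib

/-- A multi-hypergraph with labelled vertex set `V`: a finite multiset of edges, each edge being a
set of vertices. -/
structure MultiHypergraph (V : Type*) where
  edges : Multiset (Finset V)

/-- A multi-digraph with vertex set `V`: a finite multiset of arcs, `(u, v)` being an arc from `u`
to `v`. -/
structure MultiDigraph (V : Type*) where
  arcs : Multiset (V × V)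

namespace MultiDigraph

variable {V : Type*} [DecidableEq V]

/-- The arcs of `D` with parallel arcs distinguished: pairs of an arc `(u, v)` and a natural number
smaller than its multiplicity. -/
abbrev Arc (D : MultiDigraph V) : Type _ := D.arcs.ToType

/-- The in-degree, counted with multiplicity. -/
def inDegree (D : MultiDigraph V) (v : V) : ℕ := D.arcs.countP (fun a => a.2 = v)

/-- The Euler circuits of `D`: cyclic sequences of arcs, each arc starting where the previous one
ends, in which every arc (parallel arcs being distinguished) occurs exactly once. -/
def eulerCircuits (D : MultiDigraph V) : Set (Cycle D.Arc) :=
  {c | c.Chain (fun a b => a.1.2 = b.1.1) ∧ c.Nodup ∧ ∀ a : D.Arc, a ∈ c}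

/-- `D` is Eulerian if it has an Euler circuit. -/
def IsEulerian (D : MultiDigraph V) : Prop := D.eulerCircuits.Nonempty

/-- `T` is the arc set of a spanning arborescence of `D` with root `r`: no arc enters `r`, exactly
one arc enters every other vertex, and every vertex is reachable from `r`. -/
structure IsArborescence (D : MultiDigraph V) (r : V) (T : Finset D.Arc) : Prop where
  root : ∀ a ∈ T, a.1.2 ≠ r
  existsUnique : ∀ v, v ≠ r → ∃! a, a ∈ T ∧ a.1.2 = v
  reachable : ∀ v, Relation.ReflTransGen (fun u w => ∃ a ∈ T, a.1.1 = u ∧ a.1.2 = w) r v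

/-- The number of spanning arborescences of `D` with root `r`, parallel arcs being distinguished. -/
noncomputable def tau (D : MultiDigraph V) (r : V) : ℕ := {T | D.IsArborescence r T}.ncard

end MultiDigraph

namespace MultiHypergraph

variable {V : Type*}

/-- The degree of a vertex, counted with multiplicity. -/
def degree [DecidableEq V] (H : MultiHypergraph V) (v : V) : ℕ := H.edges.countP (fun e => v ∈ e)

/-- A `k`-uniform, `k`-valent multi-hypergraph. -/
structure IsVeblen [DecidableEq V] (H : MultiHypergraph V) (k : ℕ) : Prop where
  uniform : ∀ e ∈ H.edges, e.card = k
  valent : ∀ v, k ∣ H.degree v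

/-- `H` has a vertex and any two vertices are joined by a chain of edges. -/
def IsConnected (H : MultiHypergraph V) : Prop :=
  Nonempty V ∧ ∀ u v, Relation.ReflTransGen (fun x y => ∃ e ∈ H.edges, x ∈ e ∧ y ∈ e) u v

/-- The edges of `H` with repeated edges distinguished: pairs of an edge `e` and a natural number
smaller than its multiplicity. -/
abbrev Edge [DecidableEq V] (H : MultiHypergraph V) : Type _ := H.edges.ToType

/-- The sequence `(v₀, e₀), …, (vₘ₋₁, eₘ₋₁)` stands for the closed walk `v₀ e₀ v₁ e₁ … eₘ₋₁ v₀`,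
where `eᵢ = {vᵢ, vᵢ₊₁}` for all `i` modulo `m`. It is an Euler tour if every edge (repeated edges
being distinguished) occurs exactly once. -/
def IsEulerTour [DecidableEq V] (H : MultiHypergraph V) (w : List (V × H.Edge)) : Prop :=
  (w : Cycle (V × H.Edge)).Chain (fun a b => a.2.1 = {a.1, b.1}) ∧
    (w.map Prod.snd).Nodup ∧ ∀ e : H.Edge, e ∈ w.map Prod.snd

/-- The Euler circuits: Euler tours up to cyclic rotation. -/
def eulerCircuits [DecidableEq V] (H : MultiHypergraph V) : Set (Cycle (V × H.Edge)) :=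
  {c | ∃ w, H.IsEulerTour w ∧ (w : Cycle (V × H.Edge)) = c}

/-- The rootings of `H`. The pair `(e, u)` with `u ∈ e` stands for the star with edge `e` and root
`u`. A rooting is a sequence of stars whose edges are the edges of `H` with multiplicity and whose
roots are weakly increasing. -/
def rootings [LinearOrder V] (H : MultiHypergraph V) : Set (List (Finset V × V)) :=
  {R | (R.map Prod.fst : Multiset (Finset V)) = H.edges ∧ (∀ s ∈ R, s.2 ∈ s.1) ∧
    (R.map Prod.snd).Pairwise (· ≤ ·)}

/-- The arcs `(u, v)`, `v ∈ e`, `v ≠ u`, of the star with edge `e` and root `u`. -/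
def starArcs [DecidableEq V] (s : Finset V × V) : Multiset (V × V) :=
  (s.1.erase s.2).val.map (fun v => (s.2, v))

/-- The rooted multi-digraph of a sequence of stars: the union of the stars, with multiplicities
added. -/
def rootedDigraph [DecidableEq V] (R : List (Finset V × V)) : MultiDigraph V :=
  ⟨(R.map starArcs).sum⟩

/-- The Euler rootings of `H`. -/
def eulerRootings [LinearOrder V] (H : MultiHypergraph V) : Set (List (Finset V × V)) :=
  {R | R ∈ H.rootings ∧ (rootedDigraph R).IsEulerian}

theorem eulerRootings_finite [Fintype V] [LinearOrder V] (H : MultiHypergraph V) :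
    H.eulerRootings.Finite := by
  refine (List.finite_length_eq (Finset V × V) (Multiset.card H.edges)).subset ?_
  rintro R ⟨⟨h, -, -⟩, -⟩
  simp [← h]

/-- The associated coefficient of a connected Veblen hypergraph `H` with vertex set `V`: the sum
over all Euler rootings `R`, with rooted digraph `D`, of `τ_D / ∏ v, deg⁻(v)`. The function `ρ`
specifies the root at which the arborescences of `D` are counted. -/
noncomputable def assocCoeff [Fintype V] [LinearOrder V] (H : MultiHypergraph V)
    (ρ : MultiDigraph V → V) : ℚ :=
  ∑ R ∈ H.eulerRootings_finite.toFinset,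
    ((rootedDigraph R).tau (ρ (rootedDigraph R)) : ℚ) /
      ∏ v : V, ((rootedDigraph R).inDegree v : ℚ)

end MultiHypergraph

/-! Label the parallel edges. An Euler circuit of `G` leaves each labelled edge from one end, so it
determines an orientation `o` and a directed Euler circuit of the resulting digraph `D o`. Hence the
Euler circuits of `G` are counted by summing directed Euler circuits over all orientations
(`ncard_eulerCircuits`). By the BEST theorem (`ncard_eulerCycles`) an Eulerian `D` has `τ ∏ (deg v -
1)! = (τ / ∏ deg v) ∏ deg v!` circuits. The last product counts the orders `l` of the labelled edges
along which `o` is weakly increasing (`card_enumerations_pairwise`). So the number of Euler circuits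
is the sum of `τ / ∏ deg` over pairs `(o, l)` with `D o` Eulerian. Forgetting labels turns such a
pair into an Euler rooting `R`, and `(R, l)` recovers `o`. Each `R` carries `∏ m(e)!` labellings `l`
(`card_enumerations_of_mem_rootings`), so the same sum is `C_G ∏ m(e)!`. -/

/-! ### Counting enumerations of a finite set -/

section Enumerations

variable {A : Type*} [DecidableEq A]

/-- The lists in which every element of `X` occurs exactly once, and nothing else. -/
noncomputable def Finset.enumerations (X : Finset A) : Finset (List A) :=
  X.toList.permutations.toFinset

theorem Finset.mem_enumerations {X : Finset A} {l : List A} :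
    l ∈ X.enumerations ↔ l.Nodup ∧ ∀ a, a ∈ l ↔ a ∈ X := by
  rw [Finset.enumerations, List.mem_toFinset, List.mem_permutations]
  constructor
  · intro h
    exact ⟨h.nodup_iff.2 X.nodup_toList, fun a => by rw [h.mem_iff, Finset.mem_toList]⟩
  · rintro ⟨h, h'⟩
    rw [List.perm_ext_iff_of_nodup h X.nodup_toList]
    simpa using h'

theorem Finset.card_enumerations (X : Finset A) : X.enumerations.card = X.card.factorial := by
  rw [Finset.enumerations, List.toFinset_card_of_nodup (List.nodup_permutations _ X.nodup_toList),
    List.length_permutations, Finset.length_toList]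

theorem Finset.card_enumerations_head {X : Finset A} {a : A} (ha : a ∈ X) :
    (X.enumerations.filter (fun l => l.head? = some a)).card = (X.card - 1).factorial := by
  have h : X.enumerations.filter (fun l => l.head? = some a) =
      (X.erase a).enumerations.image (List.cons a) := by
    ext l
    simp only [Finset.mem_filter, Finset.mem_enumerations, Finset.mem_image, Finset.mem_erase]
    constructor
    · rintro ⟨⟨h1, h2⟩, h3⟩
      obtain _ | ⟨b, l⟩ := l
      · simp at h3
      · obtain rfl : b = a := by simpa using h3
        rw [List.nodup_cons] at h1
        refine ⟨l, ⟨h1.2, fun c => ?_⟩, rfl⟩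
        have := h2 c
        rw [List.mem_cons] at this
        constructor
        · exact fun hc => ⟨fun h => h1.1 (h ▸ hc), this.1 (Or.inr hc)⟩
        · exact fun hc => (this.2 hc.2).resolve_left hc.1
    · rintro ⟨l, ⟨h1, h2⟩, rfl⟩
      refine ⟨⟨List.nodup_cons.2 ⟨fun h => ((h2 a).1 h).1 rfl, h1⟩, fun c => ?_⟩, rfl⟩
      rw [List.mem_cons, h2]
      constructor
      · rintro (rfl | h)
        · exact ha
        · exact h.2
      · exact fun h => (em (c = a)).imp id fun h' => ⟨h', h⟩
  rw [h, Finset.card_image_of_injective _ List.cons_injective, Finset.card_enumerations,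
    Finset.card_erase_of_mem ha]

theorem Finset.card_enumerations_getLast {X : Finset A} {a : A} (ha : a ∈ X) :
    (X.enumerations.filter (fun l => l.getLast? = some a)).card = (X.card - 1).factorial := by
  rw [← Finset.card_enumerations_head ha]
  refine Finset.card_nbij List.reverse ?_ List.reverse_injective.injOn ?_
  · intro l hl
    simpa [Finset.mem_enumerations] using hl
  · intro l hl
    exact ⟨l.reverse, by simpa [Finset.mem_enumerations] using hl, l.reverse_reverse⟩

/-- A list with the multiset of values of `f` is the list of values of exactly `∏ b, |f⁻¹(b)|!`
enumerations of the domain. -/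
theorem card_enumerations_map_eq {B : Type*} [Fintype A] [Fintype B] [DecidableEq B] (f : A → B)
    (k : List B) (hk : (k : Multiset B) = Finset.univ.val.map f) :
    ((Finset.univ : Finset A).enumerations.filter (fun l => l.map f = k)).card =
      ∏ b, (Finset.univ.filter (fun a => f a = b)).card.factorial := by
  obtain ⟨l₀, hl₀, hk₀⟩ : ∃ l₀ ∈ (Finset.univ : Finset A).enumerations, l₀.map f = k := by
    have hp : k.Perm ((Finset.univ : Finset A).toList.map f) := by
      rw [← Multiset.coe_eq_coe, hk, ← Multiset.map_coe, Finset.coe_toList]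
    -- Commuting the permutation past the pointwise relation lifts a rearrangement of the values to
    -- a rearrangement of the domain.
    have : Relation.Comp List.Perm (List.Forall₂ (fun b a => b = f a)) k
        ((Finset.univ : Finset A).toList) :=
      ⟨_, hp, by simp [List.forall₂_map_left_iff, List.forall₂_same]⟩
    rw [← List.forall₂_comp_perm_eq_perm_comp_forall₂] at this
    obtain ⟨l, h1, h2⟩ := this
    refine ⟨l, ?_, ?_⟩
    · rw [Finset.mem_enumerations]
      exact ⟨h2.nodup_iff.2 (Finset.nodup_toList _), fun a => by simp [h2.mem_iff]⟩
    · have h3 := h1.flip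
      clear hk hp h1 h2
      induction h3 with
      | nil => rfl
      | cons h _ ih => simp [ih] at h ⊢; exact h.symm
  rw [Finset.mem_enumerations] at hl₀
  -- The enumerations over `k` are the `l₀.map g` with `g` a permutation preserving the fibres of
  -- `f`; there are a product of factorials of those.
  have hst := DomMulAct.stabilizer_card f
  simp only [Fintype.card_subtype] at hst
  rw [← hst]
  symm
  refine Finset.card_nbij (fun g => l₀.map g) ?_ ?_ ?_
  · intro g hg
    simp only [Finset.coe_filter, Finset.mem_univ, true_and, Set.mem_ofPred_eq] at hg
    simp only [Finset.coe_filter, Set.mem_ofPred_eq, Finset.mem_enumerations, List.map_map, hg, hk₀,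
      and_true]
    refine ⟨hl₀.1.map g.injective, fun a => ?_⟩
    simp only [List.mem_map, Finset.mem_univ, iff_true]
    exact ⟨g.symm a, by simp [hl₀.2], by simp⟩
  · intro g _ g' _ h
    ext a
    exact List.map_inj_left.1 h a ((hl₀.2 a).2 (Finset.mem_univ a))
  · intro l hl
    simp only [Finset.coe_filter, Set.mem_ofPred_eq, Finset.mem_enumerations] at hl
    obtain ⟨⟨h1, h2⟩, h3⟩ := hl
    have hlen : l₀.length = l.length := by
      simpa using congrArg List.length (hk₀.trans h3.symm)
    let e₀ := hl₀.1.getEquivOfForallMemList l₀ (fun a => (hl₀.2 a).2 (Finset.mem_univ a))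
    let e := h1.getEquivOfForallMemList l (fun a => (h2 a).2 (Finset.mem_univ a))
    let g : Equiv.Perm A := e₀.symm.trans ((finCongr hlen).trans e)
    have hg : l₀.map g = l := by
      refine List.ext_getElem (by simpa using hlen) fun i hi hi' => ?_
      have hi0 : i < l₀.length := by simpa using hi
      have : e₀.symm l₀[i] = ⟨i, hi0⟩ := by
        rw [Equiv.symm_apply_eq]; rfl
      simp only [List.getElem_map, g, Equiv.trans_apply, this]
      rfl
    refine ⟨g, ?_, hg⟩
    simp only [Finset.coe_filter, Finset.mem_univ, true_and, Set.mem_ofPred_eq]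
    funext a
    have : l₀.map (f ∘ g) = l₀.map f := by rw [← List.map_map, hg, h3, hk₀]
    exact List.map_inj_left.1 this a ((hl₀.2 a).2 (Finset.mem_univ a))

theorem List.Nodup.exists_map_eq {A B : Type*} [Nonempty B] {l : List A} (hl : l.Nodup)
    {k : List B} (h : l.length = k.length) : ∃ f : A → B, l.map f = k := by
  classical
  induction l generalizing k with
  | nil => exact ⟨fun _ => Classical.arbitrary B, by simpa [eq_comm] using h⟩
  | cons a l ih =>
    obtain _ | ⟨b, k⟩ := k
    · simp at h
    · rw [List.nodup_cons] at hl
      obtain ⟨f, hf⟩ := ih hl.2 (by simpa using h)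
      refine ⟨Function.update f a b, ?_⟩
      rw [List.map_cons, Function.update_self, ← hf]
      congr 1
      refine List.map_congr_left fun c hc => ?_
      rw [Function.update_of_ne]
      rintro rfl
      exact hl.1 hc

end Enumerations

/-! ### Walks and last exits -/

namespace ArcSystem

variable {A V : Type*} (s t : A → V)

/-- `IsWalk s t x w y`: the arcs in `w`, the arc `a` leading from `s a` to `t a`, form a walk from
`x` to `y`. -/
def IsWalk : V → List A → V → Prop
  | x, [], y => x = y
  | x, a :: l, y => s a = x ∧ IsWalk (t a) l y

variable {s t}

theorem isChain_append_singleton_iff_isWalk {a b : A} {l : List A} :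
    List.IsChain (fun a b => t a = s b) (a :: (l ++ [b])) ↔ IsWalk s t (s a) (a :: l) (s b) := by
  induction l generalizing a with
  | nil => simp [IsWalk]
  | cons c l ih =>
    rw [List.cons_append, List.isChain_cons_cons, ih]
    simp only [IsWalk, true_and]
    constructor
    · rintro ⟨h, h'⟩; exact ⟨h.symm, h'⟩
    · rintro ⟨h, h'⟩; exact ⟨h.symm, h'⟩

section
variable [DecidableEq V]

/-- A walk is determined by its starting point and the order in which the arcs leaving each vertex
are used. -/
theorem IsWalk.eq_of_filter_eq {x y y' : V} {w w' : List A} (h : IsWalk s t x w y)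
    (h' : IsWalk s t x w' y')
    (hf : ∀ v, w.filter (fun a => s a = v) = w'.filter (fun a => s a = v)) : w = w' := by
  induction w generalizing x w' with
  | nil =>
    obtain _ | ⟨b, l'⟩ := w'
    · rfl
    · simpa using hf (s b)
  | cons a l ih =>
    obtain _ | ⟨b, l'⟩ := w'
    · simpa using hf (s a)
    · obtain ⟨rfl, h⟩ := h
      obtain ⟨hb, h'⟩ := h'
      have h0 := hf (s a)
      simp only [hb, decide_true, List.filter_cons_of_pos, List.cons.injEq] at h0
      obtain ⟨rfl, -⟩ := h0
      rw [ih h h' fun v => ?_]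
      have := hf v
      by_cases hv : s a = v <;> simpa [List.filter_cons, hv] using this

/-- The last arcs by which a walk leaves the vertices different from its end `r` lead to `r`. -/
theorem IsWalk.reflTransGen_getLast {x r : V} {w : List A} (h : IsWalk s t x w r) (v : V)
    (hv : v = r ∨ ∃ a ∈ w, s a = v) :
    Relation.ReflTransGen (fun u z => ∃ a, (s a ≠ r ∧
      (w.filter (fun b => s b = s a)).getLast? = some a) ∧ t a = u ∧ s a = z) r v := by
  induction w generalizing x v with
  | nil =>
    obtain rfl | ⟨a, ha, -⟩ := hv
    · exact .refl
    · simp at ha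
  | cons a l ih =>
    obtain ⟨rfl, h⟩ := h
    -- Prepending an arc does not change the last exit from a vertex that the tail already leaves.
    have key : ∀ v, (v = r ∨ ∃ b ∈ l, s b = v) → Relation.ReflTransGen (fun u z => ∃ b, (s b ≠ r ∧
      ((a :: l).filter (fun c => s c = s b)).getLast? = some b) ∧ t b = u ∧ s b = z) r v := by
      intro v hv
      refine Relation.ReflTransGen.mono ?_ _ _ (ih h v hv)
      rintro u z ⟨b, ⟨h1, h2⟩, h3, h4⟩
      refine ⟨b, ⟨h1, ?_⟩, h3, h4⟩
      rw [List.filter_cons]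
      split_ifs
      · rw [List.getLast?_cons, h2]; rfl
      · exact h2
    by_cases hl : v = r ∨ ∃ b ∈ l, s b = v
    · exact key v hl
    · push Not at hl
      have hav : s a = v := by
        obtain h | ⟨b, hb, hbv⟩ := hv
        · exact absurd h hl.1
        · obtain rfl | hb := List.mem_cons.1 hb
          · exact hbv
          · exact absurd hbv (hl.2 b hb)
      have hta : t a = r ∨ ∃ b ∈ l, s b = t a := by
        obtain _ | ⟨b, l⟩ := l
        · exact Or.inl h
        · exact Or.inr ⟨b, by simp, h.1⟩
      -- The tail never leaves `v`, so `a` is itself the last exit from `v`, and its end is already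
      -- covered by `key`.
      refine (key _ hta).tail ⟨a, ⟨fun h => hl.1 (hav.symm.trans h), ?_⟩, rfl, hav⟩
      have : l.filter (fun c => s c = s a) = [] := by
        rw [List.filter_eq_nil_iff]
        intro b hb
        simpa [hav] using hl.2 b hb
      rw [List.filter_cons_of_pos (by simp), this]
      rfl

variable [Fintype V]

/-- Stated additively to avoid subtraction in `ℕ`. -/
theorem sum_update_add {M : Type*} [AddCommMonoid M] {B : Type*} (f : B → M) (g : V → B) (x : V)
    (b : B) : ∑ u, f (Function.update g x b u) + f (g x) = ∑ u, f (g u) + f b := by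
  rw [← Finset.add_sum_erase _ _ (Finset.mem_univ x),
    ← Finset.add_sum_erase Finset.univ (fun u => f (g u)) (Finset.mem_univ x),
    Function.update_self]
  have : ∑ u ∈ Finset.univ.erase x, f (Function.update g x b u) =
      ∑ u ∈ Finset.univ.erase x, f (g u) :=
    Finset.sum_congr rfl fun u hu => by rw [Function.update_of_ne (Finset.ne_of_mem_erase hu)]
  rw [this]
  abel

/-- Suppose that the arcs leaving each vertex are listed in some order, and that the last ones, for
the vertices other than `r`, lead to `r`. If the numbers of entering and leaving arcs balance as
for a walk from `x` to `r`, then there is such a walk that uses up the lists. -/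
theorem exists_isWalk {r : V} {T : Set A} (hT : ∀ v, Relation.ReflTransGen
      (fun u z => ∃ a ∈ T, t a = u ∧ s a = z) r v)
    (n : ℕ) (ord : V → List A) (x : V) (hn : ∑ v, (ord v).length = n)
    (hs : ∀ v, ∀ a ∈ ord v, s a = v)
    (hlast : ∀ a ∈ T, ord (s a) = [] ∨ (ord (s a)).getLast? = some a)
    (hbal : ∀ v, (ord v).length + (if v = r then 1 else 0) =
      ∑ u, (ord u).countP (fun a => t a = v) + if v = x then 1 else 0) :
    ∃ w, IsWalk s t x w r ∧ ∀ v, w.filter (fun a => s a = v) = ord v := by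
  induction n generalizing ord x with
  | zero =>
    have h0 : ∀ v, ord v = [] := by simpa using hn
    refine ⟨[], ?_, by simp [h0]⟩
    by_contra hx
    have := hbal x
    have hx' : x ≠ r := hx
    simp [h0, hx'] at this
  | succ n ih =>
    rcases hx : ord x with _ | ⟨a, l⟩
    -- Walk greedily, always taking the next listed arc. By the balance the walk can get stuck only
    -- at `r`.
    · have hxr : x = r := by
        by_contra hxr
        have := hbal x
        simp [hx, hxr] at this
      subst hxr
      -- Stuck at `r`, every list is used up. Induct along `T`: if the list at `t a` is empty,
      -- balance leaves no unused arc into `t a`; but a nonempty list at `s a` would still end in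
      -- `a`.
      have h0 : ∀ v, ord v = [] := by
        intro v
        induction hT v with
        | refl => exact hx
        | tail _ hab ih =>
          obtain ⟨a, ha, rfl, rfl⟩ := hab
          refine (hlast a ha).resolve_right fun hl => ?_
          have h1 := hbal (t a)
          rw [ih, List.length_nil, zero_add, right_eq_add, Finset.sum_eq_zero_iff] at h1
          have h2 := h1 (s a) (Finset.mem_univ _)
          rw [List.countP_eq_zero] at h2
          exact h2 a (List.mem_of_getLast? hl) (by simp)
      simp [h0] at hn
    · have hax : s a = x := hs x a (by simp [hx])
      have step : ∃ w, IsWalk s t (t a) w r ∧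
          ∀ v, w.filter (fun b => s b = v) = Function.update ord x l v := by
        refine ih _ _ ?_ ?_ ?_ ?_
        · have := sum_update_add List.length ord x l
          rw [hx, hn, List.length_cons] at this
          omega
        · intro v b hb
          by_cases hv : v = x
          · subst hv
            rw [Function.update_self] at hb
            exact hs v b (by simp [hx, hb])
          · rw [Function.update_of_ne hv] at hb
            exact hs v b hb
        · intro b hb
          by_cases hv : s b = x
          · rw [hv, Function.update_self]
            have := hlast b hb
            rw [hv, hx] at this
            obtain _ | ⟨c, l⟩ := l
            · exact Or.inl rfl
            · right
              simpa using this
          · rw [Function.update_of_ne hv]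
            exact hlast b hb
        · intro v
          have h1 := hbal v
          have h2 := sum_update_add (fun l => l.countP (fun a => t a = v)) ord x l
          simp only [hx, List.countP_cons, decide_eq_true_eq] at h2
          have h3 : (Function.update ord x l v).length + (if v = x then 1 else 0) =
              (ord v).length := by
            by_cases hv : v = x
            · subst hv; simp [hx]
            · simp [hv]
          have h4 : (if t a = v then 1 else 0) = (if v = t a then 1 else 0) := by
            simp only [eq_comm]
          rw [h4] at h2
          omega
      obtain ⟨w, hw, hwf⟩ := step
      refine ⟨a :: w, ⟨hax, hw⟩, fun v => ?_⟩
      by_cases hv : v = x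
      · subst hv
        rw [List.filter_cons_of_pos (by simpa using hax), hwf, Function.update_self, hx]
      · rw [List.filter_cons_of_neg (by simpa [hax] using Ne.symm hv), hwf,
          Function.update_of_ne hv]

end

/-- The cyclic sequences of arcs, each arc starting where the previous one ends, in which every
arc occurs exactly once. -/
def eulerCycles (s t : A → V) : Set (Cycle A) :=
  {c | c.Chain (fun a b => t a = s b) ∧ c.Nodup ∧ ∀ a, a ∈ c}

theorem chain_reverse_iff {A : Type*} {R : A → A → Prop} {c : Cycle A} :
    c.reverse.Chain R ↔ c.Chain (fun a b => R b a) := by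
  induction c using Quotient.inductionOn' with | h l
  change Cycle.Chain R ((l : Cycle A).reverse) ↔ Cycle.Chain _ (l : Cycle A)
  obtain _ | ⟨a, l⟩ := l
  · simp
  · rw [Cycle.reverse_coe, List.reverse_cons]
    have : ((l.reverse ++ [a] : List A) : Cycle A) = (a :: l.reverse : List A) :=
      Cycle.coe_eq_coe.2 List.isRotated_append
    rw [this, Cycle.chain_coe_cons, Cycle.chain_coe_cons, ← List.isChain_reverse]
    simp

/-- Reversal of circuits. It is needed because last exits form a tree towards the root, while
arborescences point away from it. -/
theorem ncard_eulerCycles_comm (s t : A → V) :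
    (eulerCycles s t).ncard = (eulerCycles t s).ncard := by
  have h : ∀ s t : A → V, ∀ c ∈ eulerCycles s t, c.reverse ∈ eulerCycles t s := by
    rintro s t c ⟨h1, h2, h3⟩
    refine ⟨chain_reverse_iff.2 (h1.imp fun _ _ => Eq.symm), Cycle.nodup_reverse_iff.2 h2,
      fun a => Cycle.mem_reverse_iff.2 (h3 a)⟩
  exact Set.ncard_congr (fun c _ => c.reverse) (h s t)
    (fun c d _ _ hcd => by simpa using congrArg Cycle.reverse hcd)
    fun c hc => ⟨c.reverse, h t s c hc, by simp⟩

theorem map_eq_map_of_mem_eulerCycles [Fintype A] {c : Cycle A} (hc : c ∈ eulerCycles s t) :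
    (Finset.univ : Finset A).val.map s = Finset.univ.val.map t := by
  induction c using Quotient.inductionOn' with | h l
  obtain ⟨h1, h2, h3⟩ := hc
  have h2' : l.Nodup := h2
  have h3' : ∀ a, a ∈ l := h3
  have hl : (Finset.univ : Finset A).val = l :=
    (Multiset.Nodup.ext Finset.univ.nodup (Multiset.coe_nodup.2 h2')).2 fun a => by simp [h3']
  -- Along a walk the ends of the arcs are their starts shifted by one place; for a closed walk this
  -- is a rotation.
  have key : ∀ (a b : A) (l : List A), IsWalk s t (s a) (a :: l) (s b) →
      (a :: l).map t = (l.map s) ++ [s b] := by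
    intro a b l h
    induction l generalizing a with
    | nil => simpa [IsWalk] using h
    | cons c l ih =>
      obtain ⟨-, h0, h1⟩ := h
      have := ih c ⟨rfl, h1⟩
      rw [List.map_cons, this, ← h0]
      simp
  rw [hl]
  obtain _ | ⟨a, l⟩ := l
  · simp
  · have hw := isChain_append_singleton_iff_isWalk.1 ((Cycle.chain_coe_cons _ a l).1 h1)
    rw [Multiset.map_coe, Multiset.map_coe, Multiset.coe_eq_coe, key a a l hw, List.map_cons]
    exact (List.perm_append_singleton _ _).symm

end ArcSystem

/-! ### The BEST theorem -/

namespace ArcSystem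

variable {A V : Type*} {s t : A → V}

/-- The Euler walks from `r` to `r` whose first arc is `a₀`. -/
def eulerWalks (s t : A → V) (r : V) (a₀ : A) : Set (List A) :=
  {w | IsWalk s t r w r ∧ w.Nodup ∧ (∀ a, a ∈ w) ∧ w.head? = some a₀}

/-- Since `a` occurs only at position 0, the rotation must be trivial. -/
theorem cons_eq_cons_of_isRotated {a : A} {l l' : List A} (h : (a :: l).Nodup)
    (hr : (a :: l) ~r (a :: l')) : a :: l = a :: l' := by
  obtain ⟨n, hn⟩ := hr
  have hlt : n % (a :: l).length < (a :: l).length := Nat.mod_lt _ (by simp)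
  rw [← List.rotate_mod] at hn
  have h1 : (a :: l)[n % (a :: l).length]? = some a := by
    rw [← List.head?_rotate hlt, hn]
    rfl
  have h2 : n % (a :: l).length = 0 := by
    rw [List.getElem?_eq_some_iff] at h1
    obtain ⟨h3, h4⟩ := h1
    exact (h.getElem_inj_iff (hj := by simp)).1 (h4.trans (by simp))
  rw [h2, List.rotate_zero] at hn
  exact hn

/-- A cycle contains `a₀` exactly once, so it can be cut open there in exactly one way. -/
theorem ncard_eulerCycles_eq_ncard_eulerWalks (a₀ : A) :
    (eulerCycles s t).ncard = (eulerWalks s t (s a₀) a₀).ncard := by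
  symm
  refine Set.BijOn.ncard_eq (f := fun w : List A => (w : Cycle A)) ⟨?_, ?_, ?_⟩
  · rintro w ⟨h1, h2, h3, h4⟩
    obtain _ | ⟨a, l⟩ := w
    · simp at h4
    · obtain rfl : a = a₀ := by simpa using h4
      exact ⟨(Cycle.chain_coe_cons _ _ _).2 (isChain_append_singleton_iff_isWalk.2 h1), h2, h3⟩
  · rintro w ⟨-, h2, -, h4⟩ w' ⟨-, -, -, h4'⟩ h
    obtain _ | ⟨a, l⟩ := w
    · simp at h4
    obtain _ | ⟨b, l'⟩ := w'
    · simp at h4'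
    obtain rfl : a = a₀ := by simpa using h4
    obtain rfl : b = a := by simpa using h4'
    exact cons_eq_cons_of_isRotated h2 (Cycle.coe_eq_coe.1 h)
  · intro c hc
    induction c using Quotient.inductionOn' with | h l
    obtain ⟨h1, h2, h3⟩ := hc
    obtain ⟨l₁, l₂, rfl⟩ := List.append_of_mem (show a₀ ∈ l from h3 a₀)
    have hr : ((a₀ :: (l₂ ++ l₁) : List A) : Cycle A) = Quotient.mk'' (l₁ ++ a₀ :: l₂) :=
      Cycle.coe_eq_coe.2 (List.isRotated_append (l := a₀ :: l₂))
    refine ⟨_, ⟨?_, ?_, ?_, rfl⟩, hr⟩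
    · rw [← hr, Cycle.chain_coe_cons] at h1
      exact isChain_append_singleton_iff_isWalk.1 h1
    · rw [← hr, Cycle.nodup_coe_iff] at h2
      exact h2
    · intro a
      rw [← Cycle.mem_coe_iff, hr]
      exact h3 a

/-- No arc of `T` leaves `r`, exactly one leaves every other vertex, and the arcs of `T` lead from
every vertex to `r`. -/
structure IsInTree (s t : A → V) (r : V) (T : Finset A) : Prop where
  root : ∀ a ∈ T, s a ≠ r
  existsUnique : ∀ v, v ≠ r → ∃! a, a ∈ T ∧ s a = v
  reachable : ∀ v, Relation.ReflTransGen (fun u w => ∃ a ∈ T, t a = u ∧ s a = w) r v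

variable [Fintype A] [DecidableEq A] [DecidableEq V]

/-- The orders of the arcs leaving `v` that are compatible with the tree `T` towards `r` and the
first arc `a₀` of a walk from `r`. -/
noncomputable def exitOrders (s : A → V) (r : V) (a₀ : A) (T : Finset A) (v : V) :
    Finset (List A) :=
  (Finset.univ.filter (fun a => s a = v)).enumerations.filter
    (fun l => if v = r then l.head? = some a₀ else ∃ a ∈ T, l.getLast? = some a)

/-- One entry is prescribed at every vertex: the first at the root, the last (the tree arc)
elsewhere. The other arcs are ordered freely. -/
theorem card_exitOrders {a₀ : A} {T : Finset A} (hT : IsInTree s t (s a₀) T) (v : V) :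
    (exitOrders s (s a₀) a₀ T v).card =
      ((Finset.univ.filter (fun a => s a = v)).card - 1).factorial := by
  unfold exitOrders
  by_cases hv : v = s a₀
  · subst hv
    simp only [if_true]
    exact Finset.card_enumerations_head (by simp)
  · simp only [if_neg hv]
    obtain ⟨a, ⟨haT, hav⟩, hu⟩ := hT.existsUnique v hv
    rw [← Finset.card_enumerations_getLast (a := a) (by simpa using hav)]
    congr 1
    refine Finset.filter_congr fun l hl => ?_
    rw [Finset.mem_enumerations] at hl
    constructor
    · rintro ⟨b, hb, hl'⟩
      have : s b = v := by simpa using (hl.2 b).1 (List.mem_of_getLast? hl')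
      rwa [← hu b ⟨hb, this⟩]
    · exact fun h => ⟨a, haT, h⟩

theorem isInTree_of_mem_eulerWalks {r : V} {a₀ : A} {w : List A} (hw : w ∈ eulerWalks s t r a₀)
    (hs : ∀ v, ∃ a, s a = v) :
    IsInTree s t r (Finset.univ.filter (fun a => s a ≠ r ∧
      (w.filter (fun b => s b = s a)).getLast? = some a)) := by
  obtain ⟨h1, h2, h3, h4⟩ := hw
  refine ⟨fun a ha => ?_, fun v hv => ?_, fun v => ?_⟩
  · simp only [Finset.mem_filter] at ha
    exact ha.2.1
  · obtain ⟨a, rfl⟩ := hs v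
    have hne : w.filter (fun b => s b = s a) ≠ [] :=
      List.ne_nil_of_mem (List.mem_filter.2 ⟨h3 a, by simp⟩)
    have hl := List.getLast?_eq_some_getLast hne
    have hb : s ((w.filter (fun b => s b = s a)).getLast hne) = s a := by
      simpa using (List.mem_filter.1 (List.getLast_mem hne)).2
    refine ⟨_, ⟨?_, hb⟩, ?_⟩
    · simp only [Finset.mem_filter, Finset.mem_univ, true_and, hb]
      exact ⟨hv, hl⟩
    · rintro c ⟨hc, hca⟩
      simp only [Finset.mem_filter, Finset.mem_univ, true_and, hca] at hc
      exact Option.some.inj (hc.2.symm.trans hl)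
  · have := h1.reflTransGen_getLast v (Or.inr ((hs v).imp fun a ha => ⟨h3 a, ha⟩))
    simpa using this

variable [Fintype V]

theorem exists_eulerWalk (hbal : (Finset.univ : Finset A).val.map s = Finset.univ.val.map t)
    {a₀ : A} {T : Finset A} (hT : IsInTree s t (s a₀) T) {ord : V → List A}
    (hord : ∀ v, ord v ∈ exitOrders s (s a₀) a₀ T v) :
    ∃ w ∈ eulerWalks s t (s a₀) a₀, ∀ v, w.filter (fun a => s a = v) = ord v := by
  simp only [exitOrders, Finset.mem_filter, Finset.mem_enumerations, Finset.mem_univ,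
    true_and] at hord
  have hlen : ∀ v, (ord v).length = (Finset.univ.filter (fun a => s a = v)).card := by
    intro v
    rw [← List.toFinset_card_of_nodup (hord v).1.1]
    congr 1
    ext a
    simp [(hord v).1.2]
  have hcount : ∀ v, ∑ u, (ord u).countP (fun a => t a = v) =
      (Finset.univ.filter (fun a => t a = v)).card := by
    intro v
    -- Sort the arcs entering `v` by their starting point.
    rw [Finset.card_eq_sum_card_fiberwise (f := s) (t := Finset.univ) (by simp)]
    refine Finset.sum_congr rfl fun u _ => ?_
    rw [List.countP_eq_length_filter, ← List.toFinset_card_of_nodup ((hord u).1.1.filter _)]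
    congr 1
    ext a
    simp [(hord u).1.2, and_comm]
  have step : ∃ w, IsWalk s t (s a₀) w (s a₀) ∧ ∀ v, w.filter (fun a => s a = v) = ord v := by
    refine exists_isWalk (T := (T : Set A)) hT.reachable _ ord (s a₀) rfl
      (fun v a ha => ((hord v).1.2 a).1 ha) ?_ ?_
    · intro a ha
      right
      have h1 := (hord (s a)).2
      rw [if_neg (hT.root a ha)] at h1
      obtain ⟨b, hb, hl⟩ := h1
      have hbs : s b = s a := ((hord (s a)).1.2 b).1 (List.mem_of_getLast? hl)
      obtain rfl : b = a := (hT.existsUnique (s a) (hT.root a ha)).unique ⟨hb, hbs⟩ ⟨ha, rfl⟩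
      exact hl
    · intro v
      rw [hlen, hcount]
      have := congrArg (Multiset.countP (· = v)) hbal
      rw [Multiset.countP_map, Multiset.countP_map] at this
      congr 1
  obtain ⟨w, hw, hf⟩ := step
  have hmem : ∀ a, a ∈ w := by
    intro a
    have : a ∈ ord (s a) := ((hord (s a)).1.2 a).2 rfl
    rw [← hf] at this
    exact List.mem_of_mem_filter this
  refine ⟨w, ⟨hw, ?_, hmem, ?_⟩, hf⟩
  -- All occurrences of `a` in `w` lie in the sublist of exits from `s a`, which has no repetition.
  · rw [List.nodup_iff_count_le_one]
    intro a
    have := List.nodup_iff_count_le_one.1 (hord (s a)).1.1 a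
    rwa [← hf, List.count_filter (by simp)] at this
  · obtain _ | ⟨a, l⟩ := w
    · exact absurd (hmem a₀) (by simp)
    · have h1 := (hord (s a₀)).2
      rw [if_pos rfl, ← hf, List.filter_cons_of_pos (by simpa using hw.1)] at h1
      exact h1

/-- The theorem of de Bruijn, van Aardenne-Ehrenfest, Smith and Tutte. -/
theorem ncard_eulerCycles (hbal : (Finset.univ : Finset A).val.map s = Finset.univ.val.map t)
    (hs : ∀ v, ∃ a, s a = v) (r : V) :
    (eulerCycles s t).ncard = {T | IsInTree s t r T}.ncard *
      ∏ v, ((Finset.univ.filter (fun a => s a = v)).card - 1).factorial := by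
  classical
  obtain ⟨a₀, rfl⟩ := hs r
  rw [ncard_eulerCycles_eq_ncard_eulerWalks a₀]
  have hfin : {T | IsInTree s t (s a₀) T}.Finite := Set.toFinite _
  have hcard : (hfin.toFinset.sigma fun T =>
      Fintype.piFinset (exitOrders s (s a₀) a₀ T)).card = {T | IsInTree s t (s a₀) T}.ncard *
      ∏ v, ((Finset.univ.filter (fun a => s a = v)).card - 1).factorial := by
    rw [Finset.card_sigma, Set.ncard_eq_toFinset_card _ hfin, ← smul_eq_mul]
    refine Finset.sum_const_nat fun T hT => ?_
    rw [Fintype.card_piFinset]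
    exact Finset.prod_congr rfl fun v _ => card_exitOrders (by simpa using hT) v
  rw [← hcard, ← Set.ncard_coe_finset]
  -- An Euler walk is encoded by its tree of last exits and its order of exits at each vertex.
  refine Set.BijOn.ncard_eq (f := fun w => ⟨Finset.univ.filter (fun a => s a ≠ s a₀ ∧
      (w.filter (fun b => s b = s a)).getLast? = some a), fun v => w.filter (fun b => s b = v)⟩)
    ⟨?_, ?_, ?_⟩
  · intro w hw
    have hT := isInTree_of_mem_eulerWalks hw hs
    obtain ⟨h1, h2, h3, h4⟩ := hw
    simp only [Finset.mem_coe, Finset.mem_sigma, Set.Finite.mem_toFinset, Set.mem_ofPred_eq,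
      Fintype.mem_piFinset]
    refine ⟨hT, fun v => ?_⟩
    simp only [exitOrders, Finset.mem_filter, Finset.mem_enumerations, Finset.mem_univ, true_and]
    refine ⟨⟨h2.filter _, fun a => by simp [h3]⟩, ?_⟩
    split_ifs with hv
    · obtain _ | ⟨a, l⟩ := w
      · simp at h4
      · rw [List.filter_cons_of_pos (by simpa [hv] using h1.1)]
        exact h4
    · obtain ⟨a, ⟨ha, hav⟩, -⟩ := hT.existsUnique v hv
      simp only [Finset.mem_filter, Finset.mem_univ, true_and] at ha
      refine ⟨a, ha, ?_⟩
      rw [← hav]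
      exact ha.2
  · intro w hw w' hw' h
    simp only [Sigma.mk.injEq, heq_eq_eq] at h
    exact hw.1.eq_of_filter_eq hw'.1 fun v => congrFun h.2 v
  · rintro ⟨T, ord⟩ h
    simp only [Finset.mem_coe, Finset.mem_sigma, Set.Finite.mem_toFinset, Set.mem_ofPred_eq,
      Fintype.mem_piFinset] at h
    obtain ⟨hT, hord⟩ := h
    obtain ⟨w, hw, hf⟩ := exists_eulerWalk hbal hT hord
    refine ⟨w, hw, ?_⟩
    simp only [Sigma.mk.injEq, heq_eq_eq]
    refine ⟨?_, funext hf⟩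
    ext a
    simp only [Finset.mem_filter, Finset.mem_univ, true_and, hf]
    have ho := hord (s a)
    simp only [exitOrders, Finset.mem_filter, Finset.mem_enumerations, Finset.mem_univ,
      true_and] at ho
    constructor
    · rintro ⟨hr, hl⟩
      rw [if_neg hr] at ho
      obtain ⟨b, hb, hl'⟩ := ho.2
      rwa [← Option.some.inj (hl'.symm.trans hl)]
    · intro ha
      have hr := hT.root a ha
      rw [if_neg hr] at ho
      obtain ⟨b, hb, hl⟩ := ho.2
      have hbs : s b = s a := (ho.1.2 b).1 (List.mem_of_getLast? hl)
      obtain rfl : b = a := (hT.existsUnique (s a) hr).unique ⟨hb, hbs⟩ ⟨ha, rfl⟩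
      exact ⟨hr, hl⟩

end ArcSystem

/-! ### Transfer to multi-digraphs -/

namespace ArcSystem

variable {A V : Type*}

theorem finite_eulerCycles [Finite A] (s t : A → V) : (eulerCycles s t).Finite := by
  classical
  have := Fintype.ofFinite A
  refine (((Finset.univ : Finset A).enumerations.finite_toSet).image
    (fun l : List A => (l : Cycle A))).subset ?_
  intro c hc
  induction c using Quotient.inductionOn' with | h l
  exact ⟨l, Finset.mem_coe.2 (Finset.mem_enumerations.2
    ⟨hc.2.1, fun a => iff_of_true (hc.2.2 a) (Finset.mem_univ a)⟩), rfl⟩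

variable [Fintype A] [DecidableEq V] {s t : A → V} {D : MultiDigraph V}

/-- Over each pair `p` both sides have as many elements as the multiplicity of `p`; the bijection
between the fibres is arbitrary. -/
theorem exists_equiv_arc (hD : D.arcs = Finset.univ.val.map (fun a => (s a, t a))) :
    ∃ φ : A ≃ D.Arc, ∀ a, (φ a).1 = (s a, t a) := by
  have h : ∀ p : V × V, Nonempty ({a // (s a, t a) = p} ≃ Fin (D.arcs.count p)) := by
    intro p
    refine ⟨Fintype.equivFinOfCardEq ?_⟩
    rw [hD, Multiset.count_map, Fintype.card_subtype]
    simp only [eq_comm]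
    rfl
  refine ⟨(Equiv.sigmaFiberEquiv (fun a => (s a, t a))).symm.trans
    (Equiv.sigmaCongrRight fun p => (h p).some), fun a => rfl⟩

theorem isEulerian_iff (hD : D.arcs = Finset.univ.val.map (fun a => (s a, t a))) :
    D.IsEulerian ↔ (eulerCycles s t).Nonempty := by
  obtain ⟨φ, hφ⟩ := exists_equiv_arc hD
  have hφ' : ∀ b : D.Arc, b.1 = (s (φ.symm b), t (φ.symm b)) := fun b => by
    rw [← hφ, Equiv.apply_symm_apply]
  constructor
  · rintro ⟨c, h1, h2, h3⟩
    induction c using Quotient.inductionOn' with | h l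
    refine ⟨((l : Cycle D.Arc)).map φ.symm, ?_, ?_, ?_⟩
    · rw [Cycle.chain_map]
      refine Cycle.Chain.imp ?_ h1
      intro a b hab
      rwa [hφ' a, hφ' b] at hab
    · exact List.Nodup.map φ.symm.injective h2
    · exact fun a => Cycle.mem_map.2 ⟨φ a, h3 _, by simp⟩
  · rintro ⟨c, h1, h2, h3⟩
    induction c using Quotient.inductionOn' with | h l
    refine ⟨((l : Cycle A)).map φ, ?_, ?_, ?_⟩
    · rw [Cycle.chain_map]
      simp only [hφ]
      exact h1
    · exact List.Nodup.map φ.injective h2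
    · exact fun a => Cycle.mem_map.2 ⟨φ.symm a, h3 _, by simp⟩

theorem inDegree_eq_card (hD : D.arcs = Finset.univ.val.map (fun a => (s a, t a))) (v : V) :
    D.inDegree v = (Finset.univ.filter (fun a => t a = v)).card := by
  rw [MultiDigraph.inDegree, hD, Multiset.countP_map]
  rfl

/-- The maps `s` and `t` are exchanged because an arborescence is an in-tree of the reversed arcs.
-/
theorem tau_eq_ncard (hD : D.arcs = Finset.univ.val.map (fun a => (s a, t a))) (r : V) :
    D.tau r = {T | IsInTree t s r T}.ncard := by
  obtain ⟨φ, hφ⟩ := exists_equiv_arc hD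
  have key : ∀ T : Finset A, IsInTree t s r T ↔ D.IsArborescence r (T.map φ.toEmbedding) := by
    intro T
    have hmem : ∀ a, φ a ∈ T.map φ.toEmbedding ↔ a ∈ T := fun a =>
      Finset.mem_map' φ.toEmbedding
    have hex : ∀ p : D.Arc → Prop, (∃ a ∈ T.map φ.toEmbedding, p a) ↔ ∃ a ∈ T, p (φ a) := by
      intro p
      rw [← φ.exists_congr_right]
      simp only [hmem]
    constructor
    · rintro ⟨h1, h2, h3⟩
      refine ⟨?_, fun v hv => ?_, by simpa only [hex, hφ] using h3⟩
      · rw [← φ.forall_congr_right]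
        simpa only [hmem, hφ] using h1
      · obtain ⟨a, ⟨ha, rfl⟩, hu⟩ := h2 v hv
        refine ⟨φ a, ⟨(hmem a).2 ha, by rw [hφ]⟩, ?_⟩
        rintro b ⟨hb, hb'⟩
        obtain ⟨c, rfl⟩ := φ.surjective b
        rw [hφ] at hb'
        rw [hu c ⟨(hmem c).1 hb, hb'⟩]
    · rintro ⟨h1, h2, h3⟩
      refine ⟨?_, fun v hv => ?_, by simpa only [hex, hφ] using h3⟩
      · rw [← φ.forall_congr_right] at h1
        simpa only [hmem, hφ] using h1
      · obtain ⟨b, ⟨hb, hb'⟩, hu⟩ := h2 v hv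
        obtain ⟨a, rfl⟩ := φ.surjective b
        rw [hφ] at hb'
        refine ⟨a, ⟨(hmem a).1 hb, hb'⟩, ?_⟩
        rintro c ⟨hc, hc'⟩
        exact φ.injective (hu (φ c) ⟨(hmem c).2 hc, by rw [hφ]; exact hc'⟩)
  rw [MultiDigraph.tau]
  symm
  refine Set.BijOn.ncard_eq (f := fun T => T.map φ.toEmbedding) ⟨?_, ?_, ?_⟩
  · exact fun T hT => (key T).1 hT
  · exact (Finset.map_injective _).injOn
  · intro T hT
    have hT' : (T.map φ.symm.toEmbedding).map φ.toEmbedding = T := by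
      rw [Finset.map_map]
      convert Finset.map_refl
      ext a
      simp
    exact ⟨T.map φ.symm.toEmbedding, (key _).2 (by rw [hT']; exact hT), hT'⟩

theorem card_filter_eq_of_mem_eulerCycles {c : Cycle A} (hc : c ∈ eulerCycles s t) (v : V) :
    (Finset.univ.filter (fun a => s a = v)).card = (Finset.univ.filter (fun a => t a = v)).card := by
  have := congrArg (Multiset.countP (· = v)) (map_eq_map_of_mem_eulerCycles hc)
  rw [Multiset.countP_map, Multiset.countP_map] at this
  exact this

/-- BEST for the reversed arcs, with `(d - 1)!` rewritten as `d! / d`. An Euler circuit makes in-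
and out-degrees agree, so the factorials may be those of the out-degrees. -/
theorem ncard_eulerCycles_eq_tau_div [Fintype V]
    (hD : D.arcs = Finset.univ.val.map (fun a => (s a, t a)))
    (hne : (eulerCycles s t).Nonempty) (hv : ∀ v, ∃ a, s a = v ∨ t a = v) (r : V) :
    ((eulerCycles s t).ncard : ℚ) = (D.tau r : ℚ) / (∏ v, (D.inDegree v : ℚ)) *
      ∏ v, ((Finset.univ.filter (fun a => s a = v)).card.factorial : ℚ) := by
  classical
  obtain ⟨c, hc⟩ := hne
  have hpos : ∀ v, 0 < (Finset.univ.filter (fun a => t a = v)).card := by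
    intro v
    obtain ⟨a, ha | ha⟩ := hv v
    · rw [← card_filter_eq_of_mem_eulerCycles hc, Finset.card_pos]
      exact ⟨a, by simpa using ha⟩
    · rw [Finset.card_pos]
      exact ⟨a, by simpa using ha⟩
  have ht : ∀ v, ∃ a, t a = v := fun v => by
    obtain ⟨a, ha⟩ := Finset.card_pos.1 (hpos v)
    exact ⟨a, by simpa using ha⟩
  rw [ncard_eulerCycles_comm, ncard_eulerCycles (map_eq_map_of_mem_eulerCycles hc).symm ht r,
    tau_eq_ncard hD]
  simp only [inDegree_eq_card hD, card_filter_eq_of_mem_eulerCycles hc]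
  push_cast
  rw [div_mul_eq_mul_div, mul_div_assoc, ← Finset.prod_div_distrib]
  congr 1
  refine Finset.prod_congr rfl fun v _ => ?_
  rw [eq_div_iff (by exact_mod_cast (hpos v).ne'), mul_comm]
  exact_mod_cast Nat.mul_factorial_pred (hpos v).ne'

end ArcSystem

/-! ### Euler circuits as oriented circuits -/

theorem List.IsChain.exists_rel_of_mem {A : Type*} {R : A → A → Prop} {l : List A} {b : A}
    (h : List.IsChain R (l ++ [b])) {a : A} (ha : a ∈ l) : ∃ c, R a c := by
  obtain ⟨l₁, l₂, rfl⟩ := List.append_of_mem ha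
  rw [List.append_assoc, List.cons_append] at h
  have h' := h.right_of_append
  obtain _ | ⟨c, l₂⟩ := l₂
  · exact ⟨b, (List.isChain_cons_cons.1 h').1⟩
  · exact ⟨c, (List.isChain_cons_cons.1 h').1⟩

theorem Cycle.Chain.exists_rel_of_mem {A : Type*} {R : A → A → Prop} {c : Cycle A}
    (h : c.Chain R) {a : A} (ha : a ∈ c) : ∃ b, R a b := by
  induction c using Quotient.inductionOn' with | h l
  obtain _ | ⟨b, l⟩ := l
  · exact absurd (show a ∈ [] from ha) (by simp)
  · have h' := (Cycle.chain_coe_cons R b l).1 h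
    exact List.IsChain.exists_rel_of_mem (l := b :: l) h' (show a ∈ b :: l from ha)

namespace MultiHypergraph

section
variable {V : Type*} [DecidableEq V]

open Classical in
/-- The end other than `u` of an edge `e` with two ends. -/
noncomputable def otherEnd (e : Finset V) (u : V) : V :=
  if h : (e.erase u).Nonempty then h.choose else u

theorem erase_eq_otherEnd {e : Finset V} (he : e.card = 2) {u : V} (hu : u ∈ e) :
    e.erase u = {otherEnd e u} := by
  have h1 : (e.erase u).card = 1 := by rw [Finset.card_erase_of_mem hu, he]
  obtain ⟨x, hx⟩ := Finset.card_eq_one.1 h1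
  have h : (e.erase u).Nonempty := by rw [hx]; exact Finset.singleton_nonempty x
  have h2 : otherEnd e u ∈ e.erase u := by
    rw [otherEnd, dif_pos h]
    exact h.choose_spec
  rw [hx] at h2 ⊢
  rw [Finset.mem_singleton.1 h2]

/-- Splits the undirected step condition into "the edge is oriented from `u`" and "its head is `x`".
-/
theorem eq_pair_iff {e : Finset V} (he : e.card = 2) {u x : V} :
    e = {u, x} ↔ u ∈ e ∧ otherEnd e u = x := by
  constructor
  · intro h
    have hu : u ∈ e := by rw [h]; simp
    refine ⟨hu, ?_⟩
    have hux : u ≠ x := by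
      rintro rfl
      rw [h] at he
      simp at he
    have := erase_eq_otherEnd he hu
    have hx : x ∈ e.erase u := Finset.mem_erase.2 ⟨hux.symm, by rw [h]; simp⟩
    rw [this, Finset.mem_singleton] at hx
    exact hx.symm
  · rintro ⟨hu, rfl⟩
    rw [← erase_eq_otherEnd he hu, Finset.insert_erase hu]

variable (G : MultiHypergraph V)

/-- The end point of an edge oriented so as to start at `o e`. -/
noncomputable def head (o : G.Edge → V) (e : G.Edge) : V := otherEnd e.1 (o e)

/-- The choices of a starting point for each edge. -/
noncomputable def orientations : Finset (G.Edge → V) := by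
  classical exact Fintype.piFinset (fun e : G.Edge => e.1)

variable {G}

theorem mem_orientations {o : G.Edge → V} : o ∈ G.orientations ↔ ∀ e, o e ∈ e.1 := by
  classical exact Fintype.mem_piFinset

theorem card_edge (hG : ∀ e ∈ G.edges, e.card = 2) (e : G.Edge) : e.1.card = 2 :=
  hG _ (Multiset.coe_mem)

theorem map_mem_eulerCircuits (hG : ∀ e ∈ G.edges, e.card = 2) {o : G.Edge → V}
    (ho : o ∈ G.orientations) {c : Cycle G.Edge} (hc : c ∈ ArcSystem.eulerCycles o (G.head o)) :
    c.map (fun e => (o e, e)) ∈ G.eulerCircuits := by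
  induction c using Quotient.inductionOn' with | h l
  obtain ⟨h1, h2, h3⟩ := hc
  have hl : (l.map (fun e => (o e, e))).map Prod.snd = l := by
    rw [List.map_map]; exact List.map_id l
  refine ⟨l.map (fun e => (o e, e)), ⟨?_, ?_, ?_⟩, rfl⟩
  · rw [← Cycle.map_coe, Cycle.chain_map]
    refine Cycle.Chain.imp ?_ h1
    intro a b hab
    exact (eq_pair_iff (card_edge hG a)).2 ⟨mem_orientations.1 ho a, hab⟩
  · rw [hl]; exact h2
  · rw [hl]; exact h3

theorem exists_map_eq_of_mem_eulerCircuits [Nonempty V] (hG : ∀ e ∈ G.edges, e.card = 2)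
    {c : Cycle (V × G.Edge)} (hc : c ∈ G.eulerCircuits) :
    ∃ o ∈ G.orientations, ∃ c' ∈ ArcSystem.eulerCycles o (G.head o),
      c'.map (fun e => (o e, e)) = c := by
  obtain ⟨w, ⟨h1, h2, h3⟩, rfl⟩ := hc
  obtain ⟨o, ho⟩ := h2.exists_map_eq (k := w.map Prod.fst) (by simp)
  rw [List.map_map, List.map_inj_left] at ho
  have hw : (w.map Prod.snd).map (fun e => (o e, e)) = w := by
    rw [List.map_map]
    conv_rhs => rw [← List.map_id w]
    exact List.map_congr_left fun p hp => Prod.ext (ho p hp) rfl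
  rw [← hw, ← Cycle.map_coe, Cycle.chain_map] at h1
  have ho' : ∀ e, o e ∈ e.1 := by
    intro e
    obtain ⟨b, hb⟩ := h1.exists_rel_of_mem (Cycle.mem_coe_iff.2 (h3 e))
    rw [hb]
    simp
  refine ⟨o, mem_orientations.2 ho', (w.map Prod.snd : List G.Edge), ⟨?_, h2, h3⟩, ?_⟩
  · exact h1.imp fun a b hab => ((eq_pair_iff (card_edge hG a)).1 hab).2
  · rw [Cycle.map_coe, hw]

/-- Each labelled edge occurs once in a circuit, paired with the vertex it is left from, so the
circuit comes from exactly one orientation. -/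
theorem ncard_eulerCircuits [Nonempty V] (hG : ∀ e ∈ G.edges, e.card = 2) :
    G.eulerCircuits.ncard =
      ∑ o ∈ G.orientations, (ArcSystem.eulerCycles o (G.head o)).ncard := by
  classical
  have hfin := fun o => ArcSystem.finite_eulerCycles o (G.head o)
  have hcard : (G.orientations.sigma fun o => (hfin o).toFinset).card =
      ∑ o ∈ G.orientations, (ArcSystem.eulerCycles o (G.head o)).ncard := by
    rw [Finset.card_sigma]
    exact Finset.sum_congr rfl fun o _ => (Set.ncard_eq_toFinset_card _ (hfin o)).symm
  rw [← hcard, ← Set.ncard_coe_finset]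
  symm
  refine Set.BijOn.ncard_eq (f := fun p => p.2.map (fun e => (p.1 e, e))) ⟨?_, ?_, ?_⟩
  · rintro ⟨o, c⟩ h
    simp only [Finset.mem_coe, Finset.mem_sigma, Set.Finite.mem_toFinset] at h
    exact map_mem_eulerCircuits hG h.1 h.2
  · rintro ⟨o, c⟩ h ⟨o', c'⟩ h' heq
    simp only [Finset.mem_coe, Finset.mem_sigma, Set.Finite.mem_toFinset] at h h'
    simp only at heq
    obtain rfl : o = o' := by
      funext e
      have : (o e, e) ∈ c'.map (fun e => (o' e, e)) := by
        rw [← heq]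
        exact Cycle.mem_map.2 ⟨e, h.2.2.2 e, rfl⟩
      obtain ⟨e', -, he'⟩ := Cycle.mem_map.1 this
      simp only [Prod.mk.injEq] at he'
      obtain ⟨h1, rfl⟩ := he'
      exact h1.symm
    have hinv : ∀ c : Cycle G.Edge, (c.map (fun e => (o e, e))).map Prod.snd = c := by
      intro c
      induction c using Quotient.inductionOn' with | h l
      change ((l : Cycle G.Edge).map _).map _ = (l : Cycle G.Edge)
      rw [Cycle.map_coe, Cycle.map_coe, List.map_map]
      exact congrArg _ (List.map_id l)
    rw [← hinv c, heq, hinv]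
  · intro c hc
    obtain ⟨o, ho, c', hc', h⟩ := exists_map_eq_of_mem_eulerCircuits hG hc
    exact ⟨⟨o, c'⟩, by simpa using ⟨ho, hc'⟩, h⟩

theorem IsConnected.exists_mem_edge (hconn : G.IsConnected) (hG : ∀ e ∈ G.edges, e.card = 2)
    (hE : G.edges ≠ 0) (v : V) : ∃ e : G.Edge, v ∈ e.1 := by
  obtain ⟨f, hf⟩ := Multiset.exists_mem_of_ne_zero hE
  obtain ⟨x, hx, hxv⟩ := Finset.exists_mem_ne (by rw [hG f hf]; omega) v
  have hex : ∃ e ∈ G.edges, v ∈ e := by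
    obtain h | ⟨y, ⟨e, he, hv, -⟩, -⟩ := (hconn.2 v x).cases_head
    · exact absurd h.symm hxv
    · exact ⟨e, he, hv⟩
  obtain ⟨e, he, hv⟩ := hex
  exact ⟨⟨e, ⟨0, Multiset.count_pos.2 he⟩⟩, hv⟩

/-- The star of a two-element edge is a single arc, and the order of the stars does not affect the
union. -/
theorem arcs_rootedDigraph (hG : ∀ e ∈ G.edges, e.card = 2) {o : G.Edge → V}
    (ho : o ∈ G.orientations) {l : List G.Edge} (hl : l.Nodup) (hl' : ∀ e, e ∈ l) :
    (rootedDigraph (l.map (fun e => (e.1, o e)))).arcs =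
      Finset.univ.val.map (fun e => (o e, G.head o e)) := by
  have hu : (Finset.univ : Finset G.Edge).val = l :=
    (Multiset.Nodup.ext Finset.univ.nodup (Multiset.coe_nodup.2 hl)).2 fun a => by simp [hl']
  have hstar : ∀ e : G.Edge, starArcs (e.1, o e) = {(o e, G.head o e)} := by
    intro e
    simp only [starArcs, erase_eq_otherEnd (card_edge hG e) (mem_orientations.1 ho e), head]
    simp
  rw [rootedDigraph, hu, Multiset.map_coe, List.map_map]
  simp only [Function.comp_def, hstar]
  clear hl hl' hu
  induction l with
  | nil => rfl
  | cons a l ih => simp only [List.map_cons, List.sum_cons, ih, Multiset.singleton_add,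
      Multiset.cons_coe]

end

end MultiHypergraph

/-! ### Rootings and the double count -/

namespace MultiHypergraph

variable {V : Type*} [LinearOrder V] {G : MultiHypergraph V}

open Classical in
theorem exists_orientation_of_mem_rootings [Nonempty V] {R : List (Finset V × V)}
    (hR : R ∈ G.rootings) {l : List G.Edge} (hl : l ∈ (Finset.univ : Finset G.Edge).enumerations)
    (hlR : l.map (fun e : G.Edge => e.1) = R.map Prod.fst) :
    ∃ o ∈ G.orientations, l.map (fun e => (e.1, o e)) = R := by
  rw [Finset.mem_enumerations] at hl
  obtain ⟨o, ho⟩ := hl.1.exists_map_eq (k := R.map Prod.snd)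
    (by simpa using congrArg List.length hlR)
  have hoR : l.map (fun e => (e.1, o e)) = R := by
    have hinj : ∀ P Q : List (Finset V × V), P.map Prod.fst = Q.map Prod.fst →
        P.map Prod.snd = Q.map Prod.snd → P = Q := by
      intro P Q h1 h2
      rw [← List.zip_unzip P, ← List.zip_unzip Q, List.unzip_eq_map, List.unzip_eq_map]
      simp only [h1, h2]
    refine hinj _ _ ?_ ?_
    · rw [← hlR, List.map_map]; rfl
    · rw [← ho, List.map_map]; rfl
  refine ⟨o, mem_orientations.2 fun e => ?_, hoR⟩
  exact hR.2.1 (e.1, o e) (hoR ▸ List.mem_map.2 ⟨e, (hl.2 e).2 (Finset.mem_univ e), rfl⟩)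

open Classical in
theorem map_mem_rootings_iff {o : G.Edge → V} (ho : o ∈ G.orientations) {l : List G.Edge}
    (hl : l ∈ (Finset.univ : Finset G.Edge).enumerations) :
    l.map (fun e => (e.1, o e)) ∈ G.rootings ↔ (l.map o).Pairwise (· ≤ ·) := by
  rw [Finset.mem_enumerations] at hl
  have hu : (Finset.univ : Finset G.Edge).val = l :=
    (Multiset.Nodup.ext Finset.univ.nodup (Multiset.coe_nodup.2 hl.1)).2 fun a => by simp [hl.2]
  have h1 : (((l.map (fun e => (e.1, o e))).map Prod.fst : List (Finset V)) :
      Multiset (Finset V)) = G.edges := by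
    rw [List.map_map]
    have := Multiset.map_univ_coe G.edges
    rw [hu] at this
    exact this
  have h2 : ∀ p ∈ l.map (fun e => (e.1, o e)), p.2 ∈ p.1 := by
    intro p hp
    obtain ⟨e, -, rfl⟩ := List.mem_map.1 hp
    exact mem_orientations.1 ho e
  have h3 : (l.map (fun e => (e.1, o e))).map Prod.snd = l.map o := by
    rw [List.map_map]; rfl
  simp only [rootings, Set.mem_ofPred_eq, h1, h3, true_and]
  exact ⟨fun h => h.2, fun h => ⟨h2, h⟩⟩

variable [Fintype V]

open Classical in
theorem card_enumerations_of_mem_rootings {R : List (Finset V × V)} (hR : R ∈ G.rootings) :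
    ((Finset.univ : Finset G.Edge).enumerations.filter
      (fun l => l.map (fun e : G.Edge => e.1) = R.map Prod.fst)).card =
      ∏ e ∈ G.edges.toFinset, (G.edges.count e).factorial := by
  have hmap : (Finset.univ : Finset G.Edge).val.map (fun e : G.Edge => e.1) = G.edges :=
    Multiset.map_univ_coe G.edges
  rw [card_enumerations_map_eq (A := G.Edge) (fun e : G.Edge => e.1) (R.map Prod.fst)
    (hR.1.trans hmap.symm)]
  have hcount : ∀ e, (Finset.univ.filter (fun a : G.Edge => a.1 = e)).card =
      G.edges.count e := by
    intro e
    conv_rhs => rw [← hmap, Multiset.count_map]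
    simp only [eq_comm (a := e)]
    rfl
  simp only [hcount]
  symm
  refine Finset.prod_subset (Finset.subset_univ _) fun e _ he => ?_
  rw [Multiset.mem_toFinset] at he
  rw [Multiset.count_eq_zero_of_notMem he, Nat.factorial_zero]

open Classical in
-- A multiset has only one weakly increasing listing, so the condition says that `l.map o` is one
-- fixed list; its preimages are then counted by the fibres of `o`.
theorem card_enumerations_pairwise (o : G.Edge → V) :
    ((Finset.univ : Finset G.Edge).enumerations.filter
      (fun l => (l.map o).Pairwise (· ≤ ·))).card =
      ∏ v, (Finset.univ.filter (fun e => o e = v)).card.factorial := by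
  rw [← card_enumerations_map_eq o ((Finset.univ.val.map o).sort (· ≤ ·)) (Multiset.sort_eq _ _)]
  congr 1
  refine Finset.filter_congr fun l hl => ?_
  rw [Finset.mem_enumerations] at hl
  have hu : (Finset.univ : Finset G.Edge).val = l :=
    (Multiset.Nodup.ext Finset.univ.nodup (Multiset.coe_nodup.2 hl.1)).2 fun a => by simp [hl.2]
  constructor
  · intro h
    refine List.Perm.eq_of_pairwise' h (Multiset.pairwise_sort _ _) ?_
    rw [← Multiset.coe_eq_coe, Multiset.sort_eq, hu, Multiset.map_coe]
  · rintro h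
    rw [h]
    exact Multiset.pairwise_sort _ _

open Classical in
theorem assocCoeff_mul_prod [Nonempty V] (hG : ∀ e ∈ G.edges, e.card = 2)
    (hv : ∀ v, ∃ e : G.Edge, v ∈ e.1) (ρ : MultiDigraph V → V) :
    G.assocCoeff ρ * ∏ e ∈ G.edges.toFinset, ((G.edges.count e).factorial : ℚ) =
      G.eulerCircuits.ncard := by
  -- The weight, including the root `ρ D`, depends only on the digraph, so it is the same for every
  -- order `l` of one orientation.
  set val : MultiDigraph V → ℚ := fun D => (D.tau (ρ D) : ℚ) / ∏ v : V, (D.inDegree v : ℚ)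
  let D (o : G.Edge → V) : MultiDigraph V := ⟨Finset.univ.val.map (fun e => (o e, G.head o e))⟩
  have hD : ∀ o ∈ G.orientations, ∀ l ∈ (Finset.univ : Finset G.Edge).enumerations,
      rootedDigraph (l.map (fun e => (e.1, o e))) = D o := by
    intro o ho l hl
    rw [Finset.mem_enumerations] at hl
    have := arcs_rootedDigraph hG ho hl.1 (fun e => (hl.2 e).2 (Finset.mem_univ e))
    rw [show D o = ⟨Finset.univ.val.map (fun e => (o e, G.head o e))⟩ from rfl, ← this]
  have hleft : G.assocCoeff ρ * ∏ e ∈ G.edges.toFinset, ((G.edges.count e).factorial : ℚ) =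
      ∑ R ∈ G.eulerRootings_finite.toFinset,
        ∑ _l ∈ (Finset.univ : Finset G.Edge).enumerations.filter
          (fun l => l.map (fun e : G.Edge => e.1) = R.map Prod.fst), val (rootedDigraph R) := by
    rw [assocCoeff, Finset.sum_mul]
    refine Finset.sum_congr rfl fun R hR => ?_
    rw [Set.Finite.mem_toFinset] at hR
    rw [Finset.sum_const, card_enumerations_of_mem_rootings hR.1, nsmul_eq_mul, mul_comm]
    push_cast
    rfl
  have hright : (G.eulerCircuits.ncard : ℚ) =
      ∑ o ∈ G.orientations.filter (fun o => (ArcSystem.eulerCycles o (G.head o)).Nonempty),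
        ∑ _l ∈ (Finset.univ : Finset G.Edge).enumerations.filter
          (fun l => (l.map o).Pairwise (· ≤ ·)), val (D o) := by
    rw [ncard_eulerCircuits hG, Finset.sum_filter]
    push_cast
    refine Finset.sum_congr rfl fun o ho => ?_
    split_ifs with hne
    · rw [Finset.sum_const, card_enumerations_pairwise, nsmul_eq_mul, mul_comm]
      push_cast
      refine ArcSystem.ncard_eulerCycles_eq_tau_div (D := D o) rfl hne (fun v => ?_) _
      obtain ⟨e, he⟩ := hv v
      refine ⟨e, ?_⟩
      by_contra hcon
      push Not at hcon
      have : v ∈ e.1.erase (o e) := Finset.mem_erase.2 ⟨hcon.1.symm, he⟩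
      rw [erase_eq_otherEnd (card_edge hG e) (mem_orientations.1 ho e),
        Finset.mem_singleton] at this
      exact hcon.2 this.symm
    -- Orientations without a directed Euler circuit contribute nothing.
    · rw [Set.not_nonempty_iff_eq_empty.1 hne, Set.ncard_empty, Nat.cast_zero]
  rw [hleft, hright, Finset.sum_sigma', Finset.sum_sigma']
  symm
  -- Keeping `l` next to the rooting makes the map injective: the roots read along `l` give back
  -- `o`.
  refine Finset.sum_nbij (fun p => ⟨p.2.map (fun e => (e.1, p.1 e)), p.2⟩) ?_ ?_ ?_ ?_
  · rintro ⟨o, l⟩ h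
    simp only [Finset.mem_sigma, Finset.mem_filter, Set.Finite.mem_toFinset] at h ⊢
    obtain ⟨⟨ho, hne⟩, hl, hsort⟩ := h
    refine ⟨⟨(map_mem_rootings_iff ho hl).2 hsort, ?_⟩, hl, by rw [List.map_map]; rfl⟩
    rw [hD o ho l hl]
    exact (ArcSystem.isEulerian_iff rfl).2 hne
  · rintro ⟨o, l⟩ h ⟨o', l'⟩ h' heq
    simp only [Finset.mem_coe, Finset.mem_sigma, Finset.mem_filter] at h
    simp only [Sigma.mk.injEq, heq_eq_eq] at heq
    obtain ⟨h1, rfl⟩ := heq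
    have hl := Finset.mem_enumerations.1 h.2.1
    have : o = o' := by
      funext e
      exact congrArg Prod.snd (List.map_inj_left.1 h1 e ((hl.2 e).2 (Finset.mem_univ e)))
    rw [this]
  · rintro ⟨R, l⟩ h
    simp only [Finset.mem_coe, Finset.mem_sigma, Finset.mem_filter, Set.Finite.mem_toFinset] at h
    obtain ⟨⟨hR, hEul⟩, hl, hlR⟩ := h
    obtain ⟨o, ho, rfl⟩ := exists_orientation_of_mem_rootings hR hl hlR
    refine ⟨⟨o, l⟩, ?_, rfl⟩
    simp only [Finset.mem_coe, Finset.mem_sigma, Finset.mem_filter]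
    rw [hD o ho l hl] at hEul
    exact ⟨⟨ho, (ArcSystem.isEulerian_iff rfl).1 hEul⟩, hl,
      (map_mem_rootings_iff ho hl).1 hR⟩
  · rintro ⟨o, l⟩ h
    simp only [Finset.mem_sigma, Finset.mem_filter] at h
    rw [hD o h.1.1 l h.2.1]

end MultiHypergraph

theorem lemma7p3 {V : Type*} [Fintype V] [LinearOrder V] (G : MultiHypergraph V)
    (hconn : G.IsConnected) (hG : G.IsVeblen 2) (hE : G.edges ≠ 0)
    (ρ : MultiDigraph V → V) :
    G.assocCoeff ρ =
      (G.eulerCircuits.ncard : ℚ) / ∏ e ∈ G.edges.toFinset, ((G.edges.count e).factorial : ℚ) := by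
  have := hconn.1
  rw [eq_div_iff (Finset.prod_ne_zero_iff.2 fun e _ => by exact_mod_cast Nat.factorial_ne_zero _)]
  exact MultiHypergraph.assocCoeff_mul_prod hG.uniform
    (hconn.exists_mem_edge hG.uniform hE) ρ
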